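/- Fix an integer $K\ge 1$. For every horizon $T$ let $\mathcal P_1,\dots,\mathcal P_K$ be probability distributions on $\mathbb R$ (they may change with $T$) with means $\mu_1,\dots,\mu_K$ and gaps $\Delta_a=\max_b\mu_b-\mu_a\ge 0$. Assume (i) $\Delta_a/\sqrt{2\log T}\to 0$ as $T\to\infty$ for every arm $a\in[K]$; (ii) $\mathcal P_a$ is $\lambda_a$-sub-Gaussian, i.e. $\mathbb E_{X\sim\mathcal P_a}\,e^{s(X-\mu_a)}\le e^{\lambda_a^2s^2/2}$ for all $s\in\mathbb R$, with $0\le\lambda_a\le B$ for all arms $a$ and horizons $T$, for some constant $B<\infty$ that does not depend on $T$ or $a$. For each $T\ge K$ run the UCB algorithm for $T$ rounds. In round $t$ an arm $A_t\in[K]$ is pulled and a reward $X_t$ is received; given $A_1,X_1,\dots,A_{t-1},X_{t-1},A_t$, the reward $X_t$ has distribution $\mathcal P_{A_t}$. In the first $K$ rounds each arm is pulled once, and for $K\le t\le T-1$ $$A_{t+1}\in\arg\max_{a}\Big(\bar X_{a,t}+\sqrt{\tfrac{2\log T}{n_{a,t}}}\Big),$$ with ties broken arbitrarily, where $n_{a,t}$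 is the number of pulls of arm $a$ in the first $t$ rounds and $\bar X_{a,t}$ is the average of the rewards they gave. Then for every $T\ge 2$ the equation $$\sum_{a=1}^K\frac{1}{\big(\sqrt{T/n^\star}+\sqrt{T\Delta_a^2/(2\log T)}\big)^2}=1$$ has a unique solution $n^\star=n^\star(T,\{\Delta_a\})>0$, and for every arm $a$, as $T\to\infty$, $$\frac{n_{a,T}}{\big(1/\sqrt{n^\star}+\sqrt{\Delta_a^2/(2\log T)}\big)^{-2}}\longrightarrow 1\quad\text{in probability.}$$ In particular, $n_{a,T}/n^\star\to1$ in probability for every arm $a$ with $\Delta_a=o\big(\sqrt{\log T/T}\big)$. -/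

import Mathlib

open MeasureTheory ProbabilityTheory Filter Topology
open scoped NNReal

namespace UCBStability

noncomputable section

/-! ### Bandit quantities.

Rounds are indexed from `0`: `A t ω : Fin K` and `X t ω : ℝ` are the arm and the reward of the
`(t + 1)`-st round.  "At time `t`" means "after the first `t` rounds", i.e. the rounds `s < t`. -/

/-- `n_{a,t}`: the number of pulls of arm `a` in the first `t` rounds. -/
def pullCount {Ω : Type*} {K : ℕ} (A : ℕ → Ω → Fin K) (a : Fin K) (t : ℕ) (ω : Ω) : ℕ :=
  ((Finset.range t).filter (fun s => A s ω = a)).card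

/-- The sample mean of the rewards obtained from arm `a` in the first `t` rounds. -/
def sampleMean {Ω : Type*} {K : ℕ} (A : ℕ → Ω → Fin K) (X : ℕ → Ω → ℝ) (a : Fin K) (t : ℕ)
    (ω : Ω) : ℝ :=
  (∑ s ∈ (Finset.range t).filter (fun s => A s ω = a), X s ω) / (pullCount A a t ω : ℝ)

/-- The upper confidence bound `X̄_{a,t} + √(2 log T / n_{a,t})` with horizon `T`. -/
def ucbIndex {Ω : Type*} {K : ℕ} (T : ℕ) (A : ℕ → Ω → Fin K) (X : ℕ → Ω → ℝ) (a : Fin K) (t : ℕ)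
    (ω : Ω) : ℝ :=
  sampleMean A X a t ω + √(2 * Real.log T / (pullCount A a t ω : ℝ))

/-- The data of the first `t` rounds. -/
def history {Ω : Type*} {K : ℕ} (A : ℕ → Ω → Fin K) (X : ℕ → Ω → ℝ) (t : ℕ) (ω : Ω) :
    Fin t → Fin K × ℝ :=
  fun s => (A s ω, X s ω)

/-- The Markov kernel `(h, a) ↦ ν a` giving the law of the next reward after the past `h`
when arm `a` is pulled. -/
def rewardKernel {K : ℕ} (ν : Fin K → Measure ℝ) (t : ℕ) :
    Kernel ((Fin t → Fin K × ℝ) × Fin K) ℝ :=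
  (Kernel.ofFunOfCountable ν).comap Prod.snd measurable_snd

/-- `A`, `X` are the arms and rewards of `T` rounds of a bandit with reward distributions `ν`:
given the past and the arm pulled now, the reward has the distribution of that arm. -/
structure IsBanditRun {Ω : Type*} [MeasurableSpace Ω] {K : ℕ} (T : ℕ) (ν : Fin K → Measure ℝ)
    (P : Measure Ω) (A : ℕ → Ω → Fin K) (X : ℕ → Ω → ℝ) : Prop where
  measurable_arm : ∀ t < T, Measurable (A t)
  measurable_reward : ∀ t < T, Measurable (X t)
  reward_law : ∀ t < T,
    HasCondDistrib (X t) (fun ω => (history A X t ω, A t ω)) (rewardKernel ν t) P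

/-- The arms are chosen by the UCB algorithm with horizon `T`: each of the `K` arms is pulled once
in the first `K` rounds, and every later round pulls an arm that maximises the upper confidence
bound (ties may be broken in any way). -/
structure IsUCB {Ω : Type*} [MeasurableSpace Ω] {K : ℕ} (T : ℕ)
    (P : Measure Ω) (A : ℕ → Ω → Fin K) (X : ℕ → Ω → ℝ) : Prop where
  initial : ∀ᵐ ω ∂P, ∀ a : Fin K, ∃ t < K, A t ω = a
  argmax : ∀ᵐ ω ∂P, ∀ t, K ≤ t → t < T →
    ∀ b : Fin K, ucbIndex T A X b t ω ≤ ucbIndex T A X (A t ω) t ω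

/-- The mean `μ_a` of arm `a`. -/
def armMean {K : ℕ} (ν : Fin K → Measure ℝ) (a : Fin K) : ℝ := ∫ x, x ∂(ν a)

/-- The gap `Δ_a = max_b μ_b - μ_a`. -/
def gap {K : ℕ} (ν : Fin K → Measure ℝ) (a : Fin K) : ℝ :=
  (⨆ b, armMean ν b) - armMean ν a

/-- `X` is `lam`-sub-Gaussian under `ν` after centring:
`E exp (s (X - E X)) ≤ exp (lam² s² / 2)` for all real `s`. -/
def IsSubGaussian (lam : ℝ≥0) (ν : Measure ℝ) : Prop :=
  HasSubgaussianMGF (fun x => x - ∫ y, y ∂ν) (lam ^ 2) ν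

/-- `n > 0` solves `∑_a (√(T / n) + √(T Δ_a² / (2 log T)))⁻² = 1`. -/
def SolvesCharEq {K : ℕ} (T : ℕ) (Δ : Fin K → ℝ) (n : ℝ) : Prop :=
  0 < n ∧ ∑ a, 1 / (√((T : ℝ) / n) + √((T : ℝ) * Δ a ^ 2 / (2 * Real.log T))) ^ 2 = 1

/-- Convergence in probability, as `T → ∞`, of random variables `Y T` to a constant `c`, where each
`Y T` may live on its own probability space. -/
def TendstoInProb {Ω : ℕ → Type*} [∀ T, MeasurableSpace (Ω T)] (P : ∀ T, Measure (Ω T))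
    (Y : ∀ T, Ω T → ℝ) (c : ℝ) : Prop :=
  ∀ ε : ℝ, 0 < ε → Tendsto (fun T => P T {ω | ε ≤ |Y T ω - c|}) atTop (𝓝 0)

end

end UCBStability

/-! Write d_a = Δ_a/√(2 log T), ρ = 1/√n⋆ and N_a = n_{a,T}. Multiplied by T, the characteristic
equation reads ∑ 1/(ρ + d_a)² = T, while the pull counts satisfy ∑ N_a = T. The claim is thus 1/√N_a
≈ ρ + d_a up to factors near one.

Concentration: Ville's inequality for exponential supermartingales, with dyadic peeling over the
number of pulls, puts all sample means at all times within ε√(2 log T / n) of the means. This fails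
with probability O(log T · T^(-c)), where c > 0 depends on ε and the variance proxy
(`measure_exists_sqrt_lt_abs_sum_le`).

Comparison: on that event the argmax rule at the last pull of a gives (1-ε)/√N_b - d_b ≤
(1+ε)/√(N_a-1) - d_a (`inv_sqrt_pullCount_sub_le`). Some arm has at least T/K pulls and d_a → 0, so
every count is eventually large and the -1 is harmless. Comparing with a best arm j in both
directions gives 1/√N_a ≈ 1/√N_j + d_a.

Perturbation: x = 1/√N_j then nearly solves ∑ 1/(x + d_a)² = T. The j-th term 1/x² is at least a
fraction 1/K of the sum, so the equation is well conditioned and x ≈ ρ (`sq_ratio_bounds`). -/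

namespace UCBStability

open scoped ENNReal


/-! ### A maximal inequality of Ville type. -/

section Maximal

variable {Ω : Type*} [MeasurableSpace Ω]

/-- Maximal inequality for a nonnegative process that does not increase in mean on the events
"the level `x` has not been reached yet". -/
theorem mul_measure_exists_le_of_setLIntegral_le (P : Measure Ω) (M : ℕ → Ω → ℝ≥0∞) (T : ℕ)
    (x : ℝ≥0∞) (hM : ∀ t ≤ T, Measurable (M t))
    (hstep : ∀ t < T, ∫⁻ ω in {ω | ∀ u ≤ t, M u ω < x}, M (t + 1) ω ∂P
      ≤ ∫⁻ ω in {ω | ∀ u ≤ t, M u ω < x}, M t ω ∂P) :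
    x * P {ω | ∃ t ≤ T, x ≤ M t ω} ≤ ∫⁻ ω, M 0 ω ∂P := by
  have hmeas : ∀ t ≤ T, MeasurableSet {ω | ∀ u ≤ t, M u ω < x} := by
    intro t ht
    have : {ω | ∀ u ≤ t, M u ω < x} = ⋂ u ∈ Set.Iic t, {ω | M u ω < x} := by
      ext; simp
    rw [this]
    refine MeasurableSet.biInter (Set.to_countable _) fun u hu => ?_
    exact measurableSet_lt (hM u (le_trans hu ht)) measurable_const
  -- Induction replaces optional stopping: mass that has reached the level is frozen at the value x,
  -- and the total never increases.
  have key : ∀ t ≤ T, ∫⁻ ω in {ω | ∀ u ≤ t, M u ω < x}, M t ω ∂P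
      + x * P {ω | ∀ u ≤ t, M u ω < x}ᶜ ≤ ∫⁻ ω, M 0 ω ∂P := by
    intro t
    induction t with
    | zero =>
      intro h0
      rw [← lintegral_add_compl (μ := P) (M 0) (hmeas 0 h0)]
      refine add_le_add le_rfl ?_
      rw [← setLIntegral_const]
      refine setLIntegral_mono (hM 0 h0) fun ω hω => ?_
      simpa using hω
    | succ t ih =>
      intro ht
      refine le_trans ?_ (ih (by omega))
      have hsub : {ω | ∀ u ≤ t + 1, M u ω < x} ⊆ {ω | ∀ u ≤ t, M u ω < x} :=
        fun ω hω u hu => hω u (by omega)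
      set E := {ω | ∀ u ≤ t, M u ω < x} with hE
      set E' := {ω | ∀ u ≤ t + 1, M u ω < x} with hE'
      have mE : MeasurableSet E := hmeas t (by omega)
      have mE' : MeasurableSet E' := hmeas (t + 1) ht
      have h1 : P E'ᶜ ≤ P Eᶜ + P (E \ E') := by
        refine le_trans (measure_mono fun ω hω => ?_) (measure_union_le _ _)
        by_cases h : ω ∈ E
        · exact Or.inr ⟨h, hω⟩
        · exact Or.inl h
      have h2 : x * P (E \ E') ≤ ∫⁻ ω in E \ E', M (t + 1) ω ∂P := by
        rw [← setLIntegral_const]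
        refine setLIntegral_mono (hM _ ht) fun ω hω => ?_
        by_contra hlt
        refine hω.2 fun u hu => ?_
        rcases Nat.le_succ_iff.1 hu with h | h
        · exact hω.1 u h
        · subst h; exact not_le.1 hlt
      have h3 : ∫⁻ ω in E', M (t + 1) ω ∂P + ∫⁻ ω in E \ E', M (t + 1) ω ∂P
          = ∫⁻ ω in E, M (t + 1) ω ∂P := by
        rw [← lintegral_inter_add_sdiff _ E mE', Set.inter_eq_right.2 hsub]
      calc _ ≤ ∫⁻ ω in E', M (t + 1) ω ∂P + x * (P Eᶜ + P (E \ E')) := by gcongr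
        _ = (∫⁻ ω in E', M (t + 1) ω ∂P + x * P (E \ E')) + x * P Eᶜ := by ring
        _ ≤ (∫⁻ ω in E', M (t + 1) ω ∂P + ∫⁻ ω in E \ E', M (t + 1) ω ∂P) + x * P Eᶜ := by
          gcongr
        _ ≤ _ := by rw [h3]; exact add_le_add (hstep t (by omega)) le_rfl
  refine le_trans ?_ (key T le_rfl)
  refine le_trans (le_of_eq ?_) le_add_self
  congr 2
  ext ω
  simp

end Maximal

/-! ### Exponential supermartingales and time-uniform concentration. -/

section Exponential

variable {Ω : Type*} {K : ℕ}

/-- The exponent contributed by one round to the exponential supermartingale of arm `a`, with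
mean `m`, variance proxy `v` and parameter `s`. -/
noncomputable def roundExponent (a : Fin K) (m v s : ℝ) (z : Fin K × ℝ) : ℝ :=
  if z.1 = a then s * (z.2 - m) - v * s ^ 2 / 2 else 0

theorem measurable_roundExponent (a : Fin K) (m v s : ℝ) :
    Measurable (roundExponent a m v s) := by
  unfold roundExponent
  refine Measurable.ite ?_ (by fun_prop) measurable_const
  exact measurable_fst (measurableSet_singleton a)

/-- The exponential supermartingale of the centred rewards of arm `a`. -/
noncomputable def expSupermart (A : ℕ → Ω → Fin K) (X : ℕ → Ω → ℝ) (a : Fin K) (m v s : ℝ)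
    (t : ℕ) (ω : Ω) : ℝ≥0∞ :=
  ENNReal.ofReal (Real.exp (∑ u ∈ Finset.range t, roundExponent a m v s (A u ω, X u ω)))

/-- The process as a function of the history. -/
noncomputable def historyExp (a : Fin K) (m v s : ℝ) (t u : ℕ) (h : Fin t → Fin K × ℝ) : ℝ≥0∞ :=
  ENNReal.ofReal (Real.exp (∑ i : Fin t,
    if (i : ℕ) < u then roundExponent a m v s (h i) else 0))

variable {A : ℕ → Ω → Fin K} {X : ℕ → Ω → ℝ}

/-- The reward law is conditional on the history, so the process and its level events must be
functions of it; one history of length t carries the values at all u ≤ t. -/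
theorem historyExp_history (a : Fin K) (m v s : ℝ) {t u : ℕ} (hu : u ≤ t) (ω : Ω) :
    historyExp a m v s t u (history A X t ω) = expSupermart A X a m v s u ω := by
  unfold historyExp expSupermart history
  congr 2
  rw [Fin.sum_univ_eq_sum_range
    (fun i => if i < u then roundExponent a m v s (A i ω, X i ω) else 0) t,
    ← Finset.sum_filter]
  congr 1
  ext i
  simp only [Finset.mem_filter, Finset.mem_range]
  omega

theorem sum_roundExponent (A : ℕ → Ω → Fin K) (X : ℕ → Ω → ℝ) (a : Fin K) (m v s : ℝ) (t : ℕ)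
    (ω : Ω) :
    ∑ u ∈ Finset.range t, roundExponent a m v s (A u ω, X u ω)
      = s * (∑ u ∈ (Finset.range t).filter (fun u => A u ω = a), (X u ω - m))
        - pullCount A a t ω * (v * s ^ 2 / 2) := by
  simp only [roundExponent]
  rw [← Finset.sum_filter, Finset.sum_sub_distrib, ← Finset.mul_sum, Finset.sum_const,
    nsmul_eq_mul, pullCount]

theorem pullCount_le (A : ℕ → Ω → Fin K) (a : Fin K) (t : ℕ) (ω : Ω) : pullCount A a t ω ≤ t :=
  (Finset.card_filter_le _ _).trans (by simp)

variable [MeasurableSpace Ω] {T : ℕ} {ν : Fin K → Measure ℝ} {P : Measure Ω}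

theorem IsBanditRun.measurable_expSupermart (h : IsBanditRun T ν P A X) (a : Fin K) (m v s : ℝ)
    {t : ℕ} (ht : t ≤ T) : Measurable (expSupermart A X a m v s t) := by
  unfold expSupermart
  refine ENNReal.measurable_ofReal.comp (Real.measurable_exp.comp ?_)
  refine Finset.measurable_sum _ fun u hu => ?_
  have hu : u < T := lt_of_lt_of_le (Finset.mem_range.1 hu) ht
  exact (measurable_roundExponent a m v s).comp
    ((h.measurable_arm u hu).prodMk (h.measurable_reward u hu))

theorem IsBanditRun.measurable_history (h : IsBanditRun T ν P A X) {t : ℕ} (ht : t ≤ T) :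
    Measurable (history A X t) := by
  refine measurable_pi_lambda _ fun u => ?_
  have hu : (u : ℕ) < T := lt_of_lt_of_le u.2 ht
  exact (h.measurable_arm u hu).prodMk (h.measurable_reward u hu)

theorem measurable_historyExp (a : Fin K) (m v s : ℝ) (t u : ℕ) :
    Measurable (historyExp a m v s t u) := by
  unfold historyExp
  refine ENNReal.measurable_ofReal.comp (Real.measurable_exp.comp ?_)
  refine Finset.measurable_sum _ fun i _ => ?_
  split_ifs
  · exact (measurable_roundExponent a m v s).comp (measurable_pi_apply i)
  · exact measurable_const

/-- The compensator v s²/2 absorbs the sub-Gaussian bound when a is pulled; otherwise the exponent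
is zero. -/
theorem lintegral_exp_roundExponent_le [∀ b, IsProbabilityMeasure (ν b)] {a : Fin K} {lam : ℝ≥0}
    (hsub : IsSubGaussian lam (ν a)) {v : ℝ} (hv : (lam : ℝ) ^ 2 ≤ v) (s : ℝ) (b : Fin K) :
    ∫⁻ x, ENNReal.ofReal (Real.exp (roundExponent a (armMean ν a) v s (b, x))) ∂(ν b) ≤ 1 := by
  by_cases hb : b = a
  · subst hb
    have hint : Integrable (fun x => Real.exp (s * (x - armMean ν b))) (ν b) :=
      hsub.integrable_exp_mul s
    have hmgf : ∫ x, Real.exp (s * (x - armMean ν b)) ∂(ν b)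
        ≤ Real.exp ((lam : ℝ) ^ 2 * s ^ 2 / 2) := by
      have := hsub.mgf_le s
      simpa [mgf, armMean] using this
    have heq : ∀ x, Real.exp (roundExponent b (armMean ν b) v s (b, x))
        = Real.exp (s * (x - armMean ν b)) * Real.exp (-(v * s ^ 2 / 2)) := by
      intro x
      rw [← Real.exp_add]
      simp [roundExponent, sub_eq_add_neg]
    simp_rw [heq]
    rw [← ofReal_integral_eq_lintegral_ofReal (hint.mul_const _)
      (Eventually.of_forall fun x => by positivity), integral_mul_const]
    rw [ENNReal.ofReal_le_one]
    calc _ ≤ Real.exp ((lam : ℝ) ^ 2 * s ^ 2 / 2) * Real.exp (-(v * s ^ 2 / 2)) := by gcongr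
      _ = Real.exp (((lam : ℝ) ^ 2 - v) * s ^ 2 / 2) := by rw [← Real.exp_add]; ring_nf
      _ ≤ 1 := by
        rw [Real.exp_le_one_iff]
        nlinarith [sq_nonneg s]
  · simp [roundExponent, hb]

/-- The supermartingale step without conditional expectations: the joint law of past, arm and reward
disintegrates along the reward kernel, and the inner integral is at most one. -/
theorem IsBanditRun.lintegral_mul_exp_roundExponent_le [IsProbabilityMeasure P]
    [∀ b, IsProbabilityMeasure (ν b)]
    (h : IsBanditRun T ν P A X) {a : Fin K} {lam : ℝ≥0}
    (hsub : IsSubGaussian lam (ν a)) {v : ℝ} (hv : (lam : ℝ) ^ 2 ≤ v) (s : ℝ) {t : ℕ} (ht : t < T)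
    {G : (Fin t → Fin K × ℝ) → ℝ≥0∞} (hG : Measurable G) :
    ∫⁻ ω, G (history A X t ω)
        * ENNReal.ofReal (Real.exp (roundExponent a (armMean ν a) v s (A t ω, X t ω))) ∂P
      ≤ ∫⁻ ω, G (history A X t ω) ∂P := by
  have hlaw := h.reward_law t ht
  have hker : ∀ z, rewardKernel ν t z = ν z.2 := fun z => rfl
  have : IsMarkovKernel (rewardKernel ν t) := ⟨fun z => by rw [hker]; infer_instance⟩
  set F : ((Fin t → Fin K × ℝ) × Fin K) × ℝ → ℝ≥0∞ := fun z => G z.1.1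
    * ENNReal.ofReal (Real.exp (roundExponent a (armMean ν a) v s (z.1.2, z.2))) with hF
  have hmF : Measurable F := by
    refine (hG.comp (by fun_prop)).mul (ENNReal.measurable_ofReal.comp (Real.measurable_exp.comp ?_))
    exact (measurable_roundExponent _ _ _ _).comp (by fun_prop)
  have hHA : Measurable fun ω => (history A X t ω, A t ω) :=
    (h.measurable_history ht.le).prodMk (h.measurable_arm t ht)
  have hall : Measurable fun ω => ((history A X t ω, A t ω), X t ω) :=
    hHA.prodMk (h.measurable_reward t ht)
  calc _ = ∫⁻ z, F z ∂(P.map fun ω => ((history A X t ω, A t ω), X t ω)) := by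
        rw [lintegral_map hmF hall]
    _ = ∫⁻ z, ∫⁻ x, F (z, x) ∂(rewardKernel ν t z) ∂(P.map fun ω => (history A X t ω, A t ω)) := by
        rw [hlaw.map_eq, Measure.lintegral_compProd hmF]
    _ ≤ ∫⁻ z, G z.1 ∂(P.map fun ω => (history A X t ω, A t ω)) := by
        refine lintegral_mono fun z => ?_
        simp only [hF, hker]
        rw [lintegral_const_mul]
        · exact mul_le_of_le_one_right' (lintegral_exp_roundExponent_le hsub hv s z.2)
        · exact ENNReal.measurable_ofReal.comp (Real.measurable_exp.comp
            ((measurable_roundExponent _ _ _ _).comp (by fun_prop)))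
    _ = _ := by
        exact lintegral_map (hG.comp measurable_fst) hHA

/-- Ville's inequality for the exponential process of one arm. -/
theorem IsBanditRun.measure_exists_exp_le_expSupermart_le [IsProbabilityMeasure P]
    [∀ b, IsProbabilityMeasure (ν b)]
    (h : IsBanditRun T ν P A X) {a : Fin K} {lam : ℝ≥0}
    (hsub : IsSubGaussian lam (ν a)) {v : ℝ} (hv : (lam : ℝ) ^ 2 ≤ v) (s y : ℝ) :
    P {ω | ∃ t ≤ T, y ≤ ∑ u ∈ Finset.range t, roundExponent a (armMean ν a) v s (A u ω, X u ω)}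
      ≤ ENNReal.ofReal (Real.exp (-y)) := by
  set M := expSupermart A X a (armMean ν a) v s with hMdef
  set x : ℝ≥0∞ := ENNReal.ofReal (Real.exp y) with hx
  have hM0 : ∀ ω, M 0 ω = 1 := fun ω => by simp [hMdef, expSupermart]
  have hmain := mul_measure_exists_le_of_setLIntegral_le P M T x
    (fun t ht => h.measurable_expSupermart a _ v s ht) (by
      intro t ht
      let S : Set (Fin t → Fin K × ℝ) :=
        {g | ∀ u ≤ t, historyExp a (armMean ν a) v s t u g < x}
      have hS : MeasurableSet S := by
        have : S = ⋂ u ∈ Set.Iic t, {g | historyExp a (armMean ν a) v s t u g < x} := by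
          ext; simp [S]
        rw [this]
        exact MeasurableSet.biInter (Set.to_countable _) fun u _ =>
          measurableSet_lt (measurable_historyExp _ _ _ _ _ _) measurable_const
      have hset : {ω | ∀ u ≤ t, M u ω < x} = history A X t ⁻¹' S := by
        ext ω
        simp only [Set.mem_ofPred_eq, Set.mem_preimage, S]
        refine forall₂_congr fun u hu => ?_
        rw [historyExp_history _ _ _ _ hu]
      have hpre : MeasurableSet (history A X t ⁻¹' S) := h.measurable_history ht.le hS
      -- The weight G is the current value of the process, restricted to pasts that have not reached
      -- the level.
      have hG : Measurable (S.indicator (historyExp a (armMean ν a) v s t t)) :=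
        (measurable_historyExp _ _ _ _ _ _).indicator hS
      have hstep := h.lintegral_mul_exp_roundExponent_le hsub hv s ht hG
      have hind : ∀ ω, S.indicator (historyExp a (armMean ν a) v s t t) (history A X t ω)
          = (history A X t ⁻¹' S).indicator (M t) ω := by
        intro ω
        by_cases hω : history A X t ω ∈ S
        · rw [Set.indicator_of_mem hω, Set.indicator_of_mem (by exact hω),
            historyExp_history _ _ _ _ le_rfl]
        · rw [Set.indicator_of_notMem hω, Set.indicator_of_notMem (by exact hω)]
      have hsucc : ∀ ω, M (t + 1) ω = M t ω
          * ENNReal.ofReal (Real.exp (roundExponent a (armMean ν a) v s (A t ω, X t ω))) := by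
        intro ω
        simp only [hMdef, expSupermart]
        rw [← ENNReal.ofReal_mul (by positivity), ← Real.exp_add, Finset.sum_range_succ]
      rw [hset, ← lintegral_indicator hpre, ← lintegral_indicator hpre]
      simp_rw [hind] at hstep
      refine le_trans (lintegral_mono fun ω => ?_) hstep
      by_cases hω : ω ∈ history A X t ⁻¹' S
      · simp only [Set.indicator_of_mem hω, hsucc]; exact le_rfl
      · simp [Set.indicator_of_notMem hω])
  have hset : {ω | ∃ t ≤ T, y ≤ ∑ u ∈ Finset.range t,
      roundExponent a (armMean ν a) v s (A u ω, X u ω)} = {ω | ∃ t ≤ T, x ≤ M t ω} := by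
    ext ω
    simp only [Set.mem_ofPred_eq]
    refine exists_congr fun t => and_congr_right fun _ => ?_
    simp only [hx, hMdef, expSupermart]
    rw [ENNReal.ofReal_le_ofReal_iff (by positivity), Real.exp_le_exp]
  rw [hset]
  simp only [hM0, lintegral_const, measure_univ, mul_one] at hmain
  rw [Real.exp_neg, ENNReal.ofReal_inv_of_pos (Real.exp_pos y)]
  rw [ENNReal.le_inv_iff_mul_le, mul_comm]
  exact hmain

/-- Uniform-in-time concentration of the centred reward sums of one arm, by peeling over dyadic
ranges of the number of pulls. -/
theorem IsBanditRun.measure_exists_sqrt_lt_abs_sum_le [IsProbabilityMeasure P]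
    [∀ b, IsProbabilityMeasure (ν b)]
    (h : IsBanditRun T ν P A X) {a : Fin K} {lam : ℝ≥0}
    (hsub : IsSubGaussian lam (ν a)) {v : ℝ} (hv : (lam : ℝ) ^ 2 ≤ v) (hv0 : 0 < v) {L : ℝ}
    (hL : 0 ≤ L) :
    P {ω | ∃ t ≤ T, 1 ≤ pullCount A a t ω ∧ √(L * pullCount A a t ω) <
        |∑ u ∈ (Finset.range t).filter (fun u => A u ω = a), (X u ω - armMean ν a)|}
      ≤ ENNReal.ofReal (2 * (Nat.log 2 T + 1) * Real.exp (-(L / (4 * v)))) := by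
  -- `s k` maximises s√L√(2^k) - 2^k v s², the exponent guaranteed when 2^k ≤ n ≤ 2·2^k and the sum
  -- exceeds √(L n); the maximum is L/(4v).
  let s : ℕ → ℝ := fun k => √L / (2 * v * √(2 ^ k))
  let E : ℝ → Set Ω := fun r => {ω | ∃ t ≤ T, L / (4 * v) ≤
    ∑ u ∈ Finset.range t, roundExponent a (armMean ν a) v r (A u ω, X u ω)}
  have hE : ∀ r, P (E r) ≤ ENNReal.ofReal (Real.exp (-(L / (4 * v)))) := fun r =>
    h.measure_exists_exp_le_expSupermart_le hsub hv r _
  have hcover : {ω | ∃ t ≤ T, 1 ≤ pullCount A a t ω ∧ √(L * pullCount A a t ω) <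
        |∑ u ∈ (Finset.range t).filter (fun u => A u ω = a), (X u ω - armMean ν a)|}
      ⊆ ⋃ k ∈ Finset.range (Nat.log 2 T + 1), (E (s k) ∪ E (-s k)) := by
    rintro ω ⟨t, ht, hn1, hlt⟩
    set n := pullCount A a t ω with hn
    set S := ∑ u ∈ (Finset.range t).filter (fun u => A u ω = a), (X u ω - armMean ν a) with hS
    set k := Nat.log 2 n with hk
    have hkT : k < Nat.log 2 T + 1 :=
      Nat.lt_succ_of_le (Nat.log_mono_right ((pullCount_le A a t ω).trans ht))
    have hlow : (2 : ℝ) ^ k ≤ n := by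
      exact_mod_cast Nat.pow_log_le_self 2 (by omega)
    have hupp : (n : ℝ) ≤ 2 * 2 ^ k := by
      have := (Nat.lt_pow_succ_log_self (b := 2) (by norm_num) n).le
      rw [pow_succ] at this
      have h' : (n : ℝ) ≤ 2 ^ k * 2 := by exact_mod_cast this
      linarith
    have hq : 0 < √((2 : ℝ) ^ k) := by positivity
    have hq2 : √((2 : ℝ) ^ k) ^ 2 = 2 ^ k := Real.sq_sqrt (by positivity)
    have hl2 : √L ^ 2 = L := Real.sq_sqrt hL
    have hbound : L / (4 * v) ≤ s k * |S| - n * (v * s k ^ 2 / 2) := by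
      have h1 : √L * √((2 : ℝ) ^ k) ≤ |S| := by
        refine le_trans ?_ hlt.le
        rw [Real.sqrt_mul hL]
        gcongr
      have h2 : L / (2 * v) ≤ s k * |S| := by
        have : s k * (√L * √((2 : ℝ) ^ k)) = L / (2 * v) := by
          simp only [s]; field_simp; exact hl2
        rw [← this]
        gcongr
      have h3 : n * (v * s k ^ 2 / 2) ≤ L / (4 * v) := by
        have : s k ^ 2 = L / (4 * v ^ 2 * 2 ^ k) := by
          simp only [s]; rw [div_pow, mul_pow, mul_pow, hq2, hl2]; norm_num
        rw [this]
        calc (n : ℝ) * (v * (L / (4 * v ^ 2 * 2 ^ k)) / 2)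
            ≤ (2 * 2 ^ k) * (v * (L / (4 * v ^ 2 * 2 ^ k)) / 2) := by gcongr
          _ = L / (4 * v) := by field_simp
      have h4 : L / (2 * v) = L / (4 * v) + L / (4 * v) := by field_simp; ring
      linarith
    simp only [Set.mem_iUnion, Finset.mem_range]
    refine ⟨k, hkT, ?_⟩
    rcases le_total 0 S with h0 | h0
    · left
      refine ⟨t, ht, ?_⟩
      rw [sum_roundExponent, ← hS, ← hn]
      rwa [abs_of_nonneg h0] at hbound
    · right
      refine ⟨t, ht, ?_⟩
      rw [sum_roundExponent, ← hS, ← hn]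
      rw [abs_of_nonpos h0] at hbound
      linarith [hbound, neg_sq (s k), congrArg (fun z => n * (v * z / 2)) (neg_sq (s k))]
  calc _ ≤ P (⋃ k ∈ Finset.range (Nat.log 2 T + 1), (E (s k) ∪ E (-s k))) := measure_mono hcover
    _ ≤ ∑ k ∈ Finset.range (Nat.log 2 T + 1), P (E (s k) ∪ E (-s k)) :=
        measure_biUnion_finset_le _ _
    _ ≤ ∑ k ∈ Finset.range (Nat.log 2 T + 1),
          ENNReal.ofReal (2 * Real.exp (-(L / (4 * v)))) := by
        refine Finset.sum_le_sum fun k _ => (measure_union_le _ _).trans ?_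
        rw [two_mul, ENNReal.ofReal_add (by positivity) (by positivity)]
        exact add_le_add (hE _) (hE _)
    _ = _ := by
        rw [Finset.sum_const, Finset.card_range, nsmul_eq_mul, ← ENNReal.ofReal_natCast,
          ← ENNReal.ofReal_mul (by positivity)]
        congr 1
        push_cast
        ring

end Exponential


/-! ### Pull counts and the comparison of indices at the last pull. -/

section PullCount

variable {Ω : Type*} {K : ℕ} {A : ℕ → Ω → Fin K} {ω : Ω}

theorem pullCount_succ (a : Fin K) (t : ℕ) :
    pullCount A a (t + 1) ω = pullCount A a t ω + if A t ω = a then 1 else 0 := by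
  unfold pullCount
  rw [Finset.range_add_one, Finset.filter_insert]
  split_ifs with h
  · rw [Finset.card_insert_of_notMem (by simp)]
  · rfl

theorem pullCount_mono (a : Fin K) {s t : ℕ} (hst : s ≤ t) :
    pullCount A a s ω ≤ pullCount A a t ω :=
  Finset.card_le_card (Finset.filter_subset_filter _ (Finset.range_mono hst))

theorem sum_pullCount (t : ℕ) : ∑ a, pullCount A a t ω = t := by
  have := Finset.card_eq_sum_card_fiberwise (s := Finset.range t) (t := Finset.univ)
    (f := fun s => A s ω) (by intro x _; simp)
  rw [Finset.card_range] at this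
  exact this.symm

theorem pullCount_eq_one_of_initial (h : ∀ a : Fin K, ∃ t < K, A t ω = a) (a : Fin K) :
    pullCount A a K ω = 1 := by
  have hge : ∀ b ∈ Finset.univ, 1 ≤ pullCount A b K ω := by
    intro b _
    obtain ⟨t, ht, hb⟩ := h b
    exact Finset.card_pos.2 ⟨t, by simp [ht, hb]⟩
  have hsum : ∑ b : Fin K, 1 = ∑ b, pullCount A b K ω := by
    rw [sum_pullCount]; simp
  exact ((Finset.sum_eq_sum_iff_of_le hge).1 hsum a (Finset.mem_univ a)).symm

theorem exists_last_pull {a : Fin K} {s T : ℕ} (hsT : s ≤ T)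
    (h : pullCount A a s ω < pullCount A a T ω) :
    ∃ t, s ≤ t ∧ t < T ∧ A t ω = a ∧ pullCount A a t ω + 1 = pullCount A a T ω := by
  induction T, hsT using Nat.le_induction with
  | base => omega
  | succ T hsT ih =>
    by_cases hA : A T ω = a
    · exact ⟨T, hsT, by omega, hA, by rw [pullCount_succ, if_pos hA]⟩
    · have heq : pullCount A a (T + 1) ω = pullCount A a T ω := by
        rw [pullCount_succ, if_neg hA, add_zero]
      rw [heq] at h ⊢
      obtain ⟨t, h1, h2, h3, h4⟩ := ih h
      exact ⟨t, h1, by omega, h3, h4⟩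

variable {X : ℕ → Ω → ℝ}

theorem abs_sampleMean_sub_le {a : Fin K} {t : ℕ} {m c : ℝ}
    (hn : 1 ≤ pullCount A a t ω)
    (h : |∑ u ∈ (Finset.range t).filter (fun u => A u ω = a), (X u ω - m)|
      ≤ c * √(pullCount A a t ω)) :
    |sampleMean A X a t ω - m| ≤ c / √(pullCount A a t ω) := by
  have hn0 : (0 : ℝ) < pullCount A a t ω := by exact_mod_cast hn
  have hs : 0 < √(pullCount A a t ω : ℝ) := Real.sqrt_pos.2 hn0
  have heq : sampleMean A X a t ω - m
      = (∑ u ∈ (Finset.range t).filter (fun u => A u ω = a), (X u ω - m))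
        / pullCount A a t ω := by
    rw [Finset.sum_sub_distrib, Finset.sum_const, nsmul_eq_mul, sampleMean]
    change _ = (_ - (pullCount A a t ω : ℝ) * m) / _
    field_simp
  rw [heq, abs_div, abs_of_pos hn0, div_le_div_iff₀ hn0 hs]
  calc _ ≤ c * √(pullCount A a t ω) * √(pullCount A a t ω) := by gcongr
    _ = _ := by rw [mul_assoc, Real.mul_self_sqrt hn0.le]

/-- If the sample means are within `ε √(2 log T / n)` of the means, then comparing the upper
confidence bounds at the last pull of `a` relates the pull counts of `a` and `b`. -/
theorem inv_sqrt_pullCount_sub_le {T : ℕ} {m : Fin K → ℝ} {ε M : ℝ} (hε : ε ≤ 1) (hKT : K ≤ T)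
    (hw : 0 < √(2 * Real.log T))
    (hinit : ∀ a : Fin K, ∃ t < K, A t ω = a)
    (hmax : ∀ t, K ≤ t → t < T → ∀ b : Fin K, ucbIndex T A X b t ω ≤ ucbIndex T A X (A t ω) t ω)
    (hgood : ∀ a, ∀ t ≤ T, 1 ≤ pullCount A a t ω →
      |sampleMean A X a t ω - m a| ≤ ε * √(2 * Real.log T) / √(pullCount A a t ω))
    (a b : Fin K) (ha : 2 ≤ pullCount A a T ω) :
    (1 - ε) / √(pullCount A b T ω) - (M - m b) / √(2 * Real.log T)
      ≤ (1 + ε) / √((pullCount A a T ω : ℝ) - 1) - (M - m a) / √(2 * Real.log T) := by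
  set w := √(2 * Real.log T) with hwdef
  have hone := pullCount_eq_one_of_initial hinit
  -- A second pull of a can only occur after the K initial rounds, where the argmax rule applies.
  obtain ⟨t, hKt, htT, hA, hcount⟩ := exists_last_pull (A := A) (a := a) (ω := ω) hKT
    (by rw [hone a]; omega)
  have hpos : ∀ c, 1 ≤ pullCount A c t ω := fun c => (hone c).ge.trans (pullCount_mono c hKt)
  have hidx : ∀ c, ucbIndex T A X c t ω
      = sampleMean A X c t ω + w / √(pullCount A c t ω) := by
    intro c
    rw [ucbIndex, Real.sqrt_div' _ (by positivity)]
  have hm := hmax t hKt htT b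
  rw [hA, hidx, hidx] at hm
  have hga := (abs_le.1 (hgood a t htT.le (hpos a))).2
  have hgb := (abs_le.1 (hgood b t htT.le (hpos b))).1
  have hca : (pullCount A a T ω : ℝ) - 1 = pullCount A a t ω := by
    rw [← hcount]; push_cast; ring
  rw [hca]
  have hsb : 0 < √(pullCount A b t ω : ℝ) :=
    Real.sqrt_pos.2 (by exact_mod_cast hpos b)
  have hsab : √(pullCount A b t ω : ℝ) ≤ √(pullCount A b T ω : ℝ) :=
    Real.sqrt_le_sqrt (Nat.cast_le.2 (pullCount_mono b htT.le))
  have hdiv : (1 - ε) / √(pullCount A b T ω : ℝ) ≤ (1 - ε) / √(pullCount A b t ω : ℝ) :=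
    div_le_div_of_nonneg_left (by linarith) hsb hsab
  have key : w * ((1 - ε) / √(pullCount A b t ω)) + m b
      ≤ w * ((1 + ε) / √(pullCount A a t ω)) + m a := by
    have e1 : w * ((1 - ε) / √(pullCount A b t ω))
      = w / √(pullCount A b t ω) - ε * w / √(pullCount A b t ω) := by ring
    have e2 : w * ((1 + ε) / √(pullCount A a t ω))
      = w / √(pullCount A a t ω) + ε * w / √(pullCount A a t ω) := by ring
    rw [e1, e2]
    linarith
  have key2 : (1 - ε) / √(pullCount A b t ω) + m b / w
      ≤ (1 + ε) / √(pullCount A a t ω) + m a / w := by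
    have := div_le_div_of_nonneg_right key hw.le
    rwa [add_div, add_div, mul_div_cancel_left₀ _ hw.ne', mul_div_cancel_left₀ _ hw.ne'] at this
  rw [sub_div M, sub_div M]
  linarith

end PullCount

/-! ### Deterministic stability of the characteristic equation. -/

section Comparison

variable {K : ℕ}

/-- Every term decreases in x, so the drop of the sum is at least that of its j-th term. This
quantitative monotonicity gives both uniqueness and stability. -/
theorem sum_sq_inv_gap_le {d : Fin K → ℝ} (hd : ∀ a, 0 ≤ d a) {j : Fin K} (hj : d j = 0)
    {x y : ℝ} (hx : 0 < x) (hxy : x ≤ y) :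
    1 / x ^ 2 - 1 / y ^ 2 ≤ ∑ a, 1 / (x + d a) ^ 2 - ∑ a, 1 / (y + d a) ^ 2 := by
  rw [← Finset.sum_sub_distrib]
  have := Finset.single_le_sum (f := fun a => 1 / (x + d a) ^ 2 - 1 / (y + d a) ^ 2)
    (s := Finset.univ) (fun a _ => ?_) (Finset.mem_univ j)
  · simpa [hj] using this
  · have : 0 < x + d a := add_pos_of_pos_of_nonneg hx (hd a)
    rw [sub_nonneg]
    gcongr

/-- Perturbation of the characteristic equation: if the numbers `r a` agree with `r j + d a` up to
a factor near one and have the same sum of inverse squares as `ρ + d a`, then they agree with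
`ρ + d a` up to a factor near one. -/
theorem sq_ratio_bounds {r d : Fin K → ℝ} (hr : ∀ a, 0 < r a) (hd : ∀ a, 0 ≤ d a) {j : Fin K}
    (hj : d j = 0) {q ρ S : ℝ} (hρ : 0 < ρ) (hq : 1 ≤ q) (hκ : K * (q - 1) ≤ 1)
    (h1 : ∀ b, r b ^ 2 ≤ q * (r j + d b) ^ 2) (h2 : ∀ b, (r j + d b) ^ 2 ≤ q * r b ^ 2)
    (hsum : ∑ a, 1 / r a ^ 2 = S) (hsum' : ∑ a, 1 / (ρ + d a) ^ 2 = S) (a : Fin K) :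
    (1 - K * (q - 1)) / q ≤ (ρ + d a) ^ 2 / r a ^ 2 ∧
      (ρ + d a) ^ 2 / r a ^ 2 ≤ (1 + K * (q - 1)) * q := by
  set x := r j with hx
  set κ : ℝ := K * (q - 1) with hκdef
  have hx0 : 0 < x := hr j
  have hκ0 : 0 ≤ κ := mul_nonneg (by positivity) (by linarith)
  have hxd : ∀ b, 0 < x + d b := fun b => add_pos_of_pos_of_nonneg hx0 (hd b)
  have hρd : ∀ b, 0 < ρ + d b := fun b => add_pos_of_pos_of_nonneg hρ (hd b)
  have hS0 : 0 ≤ S := hsum ▸ Finset.sum_nonneg fun b _ => by positivity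
  have hup : ∑ b, 1 / (x + d b) ^ 2 ≤ q * S := by
    rw [← hsum, Finset.mul_sum]
    refine Finset.sum_le_sum fun b _ => ?_
    have := hr b
    have := hxd b
    rw [mul_one_div, div_le_div_iff₀ (by positivity) (by positivity), one_mul]
    exact h1 b
  have hlo : S ≤ q * ∑ b, 1 / (x + d b) ^ 2 := by
    rw [← hsum, Finset.mul_sum]
    refine Finset.sum_le_sum fun b _ => ?_
    have := hr b
    have := hxd b
    rw [mul_one_div, div_le_div_iff₀ (by positivity) (by positivity), one_mul]
    exact h2 b
  have hSρ : S ≤ K * (1 / ρ ^ 2) := by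
    have : ∑ b, 1 / (ρ + d b) ^ 2 ≤ ∑ _b : Fin K, 1 / ρ ^ 2 := by
      refine Finset.sum_le_sum fun b _ => ?_
      have := hd b
      gcongr
      linarith
    rw [hsum'] at this
    simpa using this
  -- The relative error q - 1 of the sum becomes an error relative to the j-th term alone; the loss
  -- is the factor K in κ.
  have hSκ : (q - 1) * S ≤ κ * (1 / ρ ^ 2) := by
    rw [hκdef]
    nlinarith [mul_le_mul_of_nonneg_left hSρ (sub_nonneg.2 hq)]
  have hmain : (1 - κ) * (x + d a) ^ 2 ≤ (ρ + d a) ^ 2 ∧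
      (ρ + d a) ^ 2 ≤ (1 + κ) * (x + d a) ^ 2 := by
    have hda := hd a
    rcases le_total ρ x with hle | hle
    · have hgap := sum_sq_inv_gap_le hd hj hρ hle
      rw [hsum'] at hgap
      have hdiff : S - ∑ b, 1 / (x + d b) ^ 2 ≤ (q - 1) * S := by
        nlinarith
      have h3 : (1 - κ) * (1 / ρ ^ 2) ≤ 1 / x ^ 2 := by linarith
      have h4 : (1 - κ) * x ^ 2 ≤ ρ ^ 2 := by
        rw [mul_one_div, div_le_div_iff₀ (by positivity) (by positivity), one_mul] at h3
        exact h3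
      -- A linear version, from (1-κ)² ≤ 1-κ, controls the cross term 2 x d_a in the expanded
      -- squares.
      have h5 : (1 - κ) * x ≤ ρ := by
        refine le_of_sq_le_sq ?_ hρ.le
        nlinarith [mul_nonneg hκ0 (mul_nonneg (sub_nonneg.2 hκ) (sq_nonneg x))]
      have h6 : (x + d a) ^ 2 ≥ (ρ + d a) ^ 2 := by gcongr
      constructor
      · nlinarith [mul_le_mul_of_nonneg_right h5 hda, mul_nonneg hκ0 (sq_nonneg (d a))]
      · nlinarith [mul_nonneg hκ0 (sq_nonneg (x + d a))]
    · have hgap := sum_sq_inv_gap_le hd hj hx0 hle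
      rw [hsum'] at hgap
      have h3 : 1 / x ^ 2 ≤ (1 + κ) * (1 / ρ ^ 2) := by linarith
      have h4 : ρ ^ 2 ≤ (1 + κ) * x ^ 2 := by
        rw [mul_one_div, div_le_div_iff₀ (by positivity) (by positivity), one_mul] at h3
        exact h3
      have h5 : ρ ≤ (1 + κ) * x := by
        refine le_of_sq_le_sq ?_ (by positivity)
        nlinarith [mul_nonneg hκ0 (mul_nonneg (add_nonneg zero_le_one hκ0) (sq_nonneg x))]
      have h6 : (x + d a) ^ 2 ≤ (ρ + d a) ^ 2 := by gcongr
      constructor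
      · nlinarith [mul_nonneg hκ0 (sq_nonneg (x + d a))]
      · nlinarith [mul_le_mul_of_nonneg_right h5 hda, mul_nonneg hκ0 (sq_nonneg (d a))]
  have hra : 0 < r a ^ 2 := pow_pos (hr a) 2
  constructor
  · rw [div_le_div_iff₀ (by linarith) hra]
    calc (1 - κ) * r a ^ 2 ≤ (1 - κ) * (q * (x + d a) ^ 2) :=
          mul_le_mul_of_nonneg_left (h1 a) (by linarith)
      _ = ((1 - κ) * (x + d a) ^ 2) * q := by ring
      _ ≤ _ := mul_le_mul_of_nonneg_right hmain.1 (by linarith)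
  · rw [div_le_iff₀ hra]
    calc (ρ + d a) ^ 2 ≤ (1 + κ) * (x + d a) ^ 2 := hmain.2
      _ ≤ (1 + κ) * (q * r a ^ 2) := mul_le_mul_of_nonneg_left (h2 a) (by linarith)
      _ = _ := by ring

/-- Counts that satisfy the pairwise inequalities of the upper confidence bounds and are all
large solve the characteristic equation up to a factor near one. -/
theorem count_ratio_bounds {N : Fin K → ℕ} {d : Fin K → ℝ} (hd : ∀ a, 0 ≤ d a) {j : Fin K}
    (hj : d j = 0) {ε q ρ S : ℝ} (hε0 : 0 < ε) (hε1 : ε < 1) (hρ : 0 < ρ)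
    (hqε : ((1 + ε) ^ 2 / (1 - ε)) ^ 2 = q) (hκ : K * (q - 1) ≤ 1)
    (hN : ∀ a, 2 ≤ N a) (hNε : ∀ a, 1 + 1 / (2 * ε) ≤ N a)
    (hpair : ∀ a b, (1 - ε) / √(N b) - d b ≤ (1 + ε) / √((N a : ℝ) - 1) - d a)
    (hsum : ∑ a, (N a : ℝ) = S) (hsum' : ∑ a, 1 / (ρ + d a) ^ 2 = S) (a : Fin K) :
    (1 - K * (q - 1)) / q ≤ N a * (ρ + d a) ^ 2 ∧
      N a * (ρ + d a) ^ 2 ≤ (1 + K * (q - 1)) * q := by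
  have hN0 : ∀ a, (0 : ℝ) < N a := fun a => by
    exact_mod_cast (by norm_num : 0 < 2).trans_le (hN a)
  have hN1 : ∀ a, (0 : ℝ) < (N a : ℝ) - 1 := fun a => by
    have : (2 : ℝ) ≤ N a := by exact_mod_cast hN a
    linarith
  have hr : ∀ a, (0 : ℝ) < 1 / √(N a : ℝ) := fun a => by have := hN0 a; positivity
  have hr2 : ∀ a, (1 / √(N a : ℝ)) ^ 2 = 1 / N a := fun a => by
    rw [div_pow, Real.sq_sqrt (hN0 a).le, one_pow]
  -- Since N ≥ 1 + 1/(2ε), N ≤ (1+2ε)(N-1) ≤ (1+ε)²(N-1): passing from N-1 to N costs one more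
  -- factor 1+ε.
  have hpred : ∀ a, (1 + ε) / √((N a : ℝ) - 1) ≤ (1 + ε) ^ 2 * (1 / √(N a : ℝ)) := by
    intro a
    have h1 : 1 ≤ 2 * ε * ((N a : ℝ) - 1) := by
      have := hNε a
      have h' : 1 / (2 * ε) ≤ (N a : ℝ) - 1 := by linarith
      rwa [div_le_iff₀ (by positivity), mul_comm] at h'
    have h2 : √(N a : ℝ) ≤ (1 + ε) * √((N a : ℝ) - 1) := by
      rw [Real.sqrt_le_left (by positivity), mul_pow, Real.sq_sqrt (hN1 a).le]
      nlinarith [mul_nonneg (sq_nonneg ε) (hN1 a).le]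
    have h3 : 0 < √((N a : ℝ) - 1) := Real.sqrt_pos.2 (hN1 a)
    have h4 : 0 < √(N a : ℝ) := Real.sqrt_pos.2 (hN0 a)
    rw [mul_one_div, div_le_div_iff₀ h3 h4]
    nlinarith [mul_le_mul_of_nonneg_left h2 (by linarith : (0 : ℝ) ≤ 1 + ε)]
  have hp : ∀ a b, (1 - ε) * (1 / √(N b : ℝ)) - d b ≤ (1 + ε) ^ 2 * (1 / √(N a : ℝ)) - d a := by
    intro a b
    have h1 := hpair a b
    have h2 := hpred a
    rw [mul_one_div]
    linarith
  have h1ε : 0 < 1 - ε := by linarith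
  set r : Fin K → ℝ := fun a => 1 / √(N a : ℝ) with hrdef
  have hq1 : 1 ≤ q := by
    rw [← hqε]
    refine one_le_pow₀ ?_
    rw [le_div_iff₀ h1ε]
    nlinarith
  have b1 : ∀ b, r b ^ 2 ≤ q * (r j + d b) ^ 2 := by
    intro b
    rw [← hqε, ← mul_pow]
    have : r b ≤ (1 + ε) ^ 2 / (1 - ε) * (r j + d b) := by
      rw [div_mul_eq_mul_div, le_div_iff₀ h1ε]
      have := hp j b
      rw [hj] at this
      nlinarith [mul_nonneg (by nlinarith : 0 ≤ (1 + ε) ^ 2 - 1) (hd b)]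
    have := hr b
    gcongr
  have b2 : ∀ b, (r j + d b) ^ 2 ≤ q * r b ^ 2 := by
    intro b
    rw [← hqε, ← mul_pow]
    have : r j + d b ≤ (1 + ε) ^ 2 / (1 - ε) * r b := by
      rw [div_mul_eq_mul_div, le_div_iff₀ h1ε]
      have := hp b j
      rw [hj] at this
      nlinarith [mul_nonneg hε0.le (hd b)]
    have := hr j
    have := hd b
    gcongr
  have hsr : ∑ a, 1 / r a ^ 2 = S := by
    rw [← hsum]
    refine Finset.sum_congr rfl fun a _ => ?_
    rw [hrdef]
    simp only [hr2, one_div_one_div]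
  have := sq_ratio_bounds hr hd hj hρ hq1 hκ b1 b2 hsr hsum' a
  have heq : (ρ + d a) ^ 2 / r a ^ 2 = N a * (ρ + d a) ^ 2 := by
    rw [hrdef]
    simp only [hr2]
    rw [div_div_eq_mul_div, div_one, mul_comm]
  rwa [heq] at this

/-- The pairwise inequalities force every count to be large once the horizon is large and the
scaled gaps are small. -/
theorem le_count_of_pairwise {N : Fin K → ℕ} {d : Fin K → ℝ} (hd : ∀ a, 0 ≤ d a) (j : Fin K)
    {ε M T : ℝ} (hε0 : 0 < ε) (hε1 : ε < 1) (hM : 0 < M) (hT : 2 * K ≤ T)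
    (hN : ∀ a, 1 ≤ N a)
    (hpair : ∀ a b, 2 ≤ N a → (1 - ε) / √(N b) - d b ≤ (1 + ε) / √((N a : ℝ) - 1) - d a)
    (hsum : ∑ a, (N a : ℝ) = T) (a : Fin K)
    (hlarge : d a + 2 / √(T / K - 1) ≤ (1 - ε) / √M) : M ≤ N a := by
  have hK : (0 : ℝ) < K := by exact_mod_cast j.pos
  -- Pigeonhole; this arm b has a small confidence width and is compared with a.
  obtain ⟨b, hb⟩ : ∃ b, T / K ≤ N b := by
    by_contra! hcon
    have : ∑ b, (N b : ℝ) < ∑ _b : Fin K, T / K :=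
      Finset.sum_lt_sum_of_nonempty ⟨j, Finset.mem_univ j⟩ fun b _ => hcon b
    rw [hsum] at this
    simp only [Finset.sum_const, Finset.card_univ, Fintype.card_fin, nsmul_eq_mul] at this
    rw [mul_div_cancel₀ _ hK.ne'] at this
    exact lt_irrefl _ this
  have hTK : 2 ≤ T / K := by rw [le_div_iff₀ hK]; exact hT
  have hb2 : 2 ≤ N b := by exact_mod_cast hTK.trans hb
  have h1 := hpair b a hb2
  have h2 : (1 + ε) / √((N b : ℝ) - 1) ≤ 2 / √(T / K - 1) := by
    have : 0 < √(T / K - 1) := Real.sqrt_pos.2 (by linarith)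
    gcongr
    linarith
  have h3 : (1 - ε) / √(N a : ℝ) ≤ (1 - ε) / √M := by
    have := hd b
    linarith
  have hNa : 0 < √(N a : ℝ) := Real.sqrt_pos.2 (by exact_mod_cast hN a)
  rw [div_le_div_iff_of_pos_left (by linarith) hNa (Real.sqrt_pos.2 hM)] at h3
  exact (Real.sqrt_le_sqrt_iff (by positivity)).1 h3

end Comparison


/-! ### Elementary facts on gaps. -/

section Gap

variable {K : ℕ} (ν : Fin K → Measure ℝ)

theorem gap_nonneg (a : Fin K) : 0 ≤ gap ν a :=
  sub_nonneg.2 (le_ciSup (f := armMean ν) (Set.finite_range _).bddAbove a)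

theorem exists_gap_eq_zero (hK : 0 < K) : ∃ j, gap ν j = 0 := by
  have : Nonempty (Fin K) := ⟨⟨0, hK⟩⟩
  obtain ⟨j, hj⟩ := exists_eq_ciSup_of_finite (f := armMean ν)
  exact ⟨j, by rw [gap, ← hj, sub_self]⟩

end Gap

/-! ### Existence and uniqueness for the characteristic equation. -/

section CharEq

variable {K : ℕ}

/-- Pulling √T out of each bracket gives the form that matches ∑ N_a = T. -/
theorem solvesCharEq_iff {T : ℕ} (hT : 0 < T) {Δ : Fin K → ℝ} {n : ℝ} :
    SolvesCharEq T Δ n ↔ 0 < n ∧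
      ∑ a, 1 / (1 / √n + √(Δ a ^ 2 / (2 * Real.log T))) ^ 2 = (T : ℝ) := by
  refine and_congr_right fun hn => ?_
  have hT0 : (0 : ℝ) < T := by exact_mod_cast hT
  have hterm : ∀ a, 1 / (√((T : ℝ) / n) + √((T : ℝ) * Δ a ^ 2 / (2 * Real.log T))) ^ 2
      = (T : ℝ)⁻¹ * (1 / (1 / √n + √(Δ a ^ 2 / (2 * Real.log T))) ^ 2) := by
    intro a
    rw [mul_div_assoc, Real.sqrt_mul hT0.le, div_eq_mul_one_div (T : ℝ) n, Real.sqrt_mul hT0.le,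
      ← mul_add, mul_pow, Real.sq_sqrt hT0.le, Real.sqrt_div zero_le_one, Real.sqrt_one]
    field_simp
  simp_rw [hterm]
  rw [← Finset.mul_sum, inv_mul_eq_one₀ hT0.ne']
  exact eq_comm

/-- Intermediate values: at √(1/S) the j-th term alone is S, and at √(K/S) each of the K terms is at
most S/K. -/
theorem exists_sum_inv_sq_eq {d : Fin K → ℝ} (hd : ∀ a, 0 ≤ d a) {j : Fin K} (hj : d j = 0)
    {S : ℝ} (hS : 0 < S) : ∃ ρ, 0 < ρ ∧ ∑ a, 1 / (ρ + d a) ^ 2 = S := by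
  have hK : (1 : ℝ) ≤ K := by exact_mod_cast j.pos
  have hpos : 0 < √(1 / S) := Real.sqrt_pos.2 (by positivity)
  have hle : √(1 / S) ≤ √(K / S) := Real.sqrt_le_sqrt (by gcongr)
  have hcont : ContinuousOn (fun ρ => ∑ a, 1 / (ρ + d a) ^ 2) (Set.Icc √(1 / S) √(K / S)) := by
    refine continuousOn_finsetSum _ fun a _ => ?_
    refine ContinuousOn.div continuousOn_const (by fun_prop) fun x hx => ?_
    have : 0 < x + d a := add_pos_of_pos_of_nonneg (hpos.trans_le hx.1) (hd a)
    positivity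
  have hmem : S ∈ Set.Icc (∑ a, 1 / (√(K / S) + d a) ^ 2) (∑ a, 1 / (√(1 / S) + d a) ^ 2) := by
    constructor
    · calc ∑ a, 1 / (√(K / S) + d a) ^ 2 ≤ ∑ _a : Fin K, 1 / √(K / S) ^ 2 := by
            refine Finset.sum_le_sum fun a _ => ?_
            have := hd a
            have : 0 < √(K / S) := hpos.trans_le hle
            gcongr
            linarith
        _ = S := by
            rw [Real.sq_sqrt (by positivity), Finset.sum_const, Finset.card_univ, Fintype.card_fin,
              nsmul_eq_mul]
            field_simp
    · calc S = 1 / (√(1 / S) + d j) ^ 2 := by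
            rw [hj, add_zero, Real.sq_sqrt (by positivity), one_div_one_div]
        _ ≤ _ := Finset.single_le_sum (f := fun a => 1 / (√(1 / S) + d a) ^ 2)
            (fun a _ => by positivity) (Finset.mem_univ j)
  obtain ⟨ρ, hρ, heq⟩ := intermediate_value_Icc' hle hcont hmem
  exact ⟨ρ, hpos.trans_le hρ.1, heq⟩

theorem eq_of_sum_inv_sq_eq {d : Fin K → ℝ} (hd : ∀ a, 0 ≤ d a) {j : Fin K} (hj : d j = 0)
    {x y : ℝ} (hx : 0 < x) (hy : 0 < y)
    (h : ∑ a, 1 / (x + d a) ^ 2 = ∑ a, 1 / (y + d a) ^ 2) : x = y := by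
  wlog hxy : x ≤ y generalizing x y
  · exact (this hy hx h.symm (le_of_not_ge hxy)).symm
  have := sum_sq_inv_gap_le hd hj hx hxy
  rw [h, sub_self, sub_nonpos, one_div_le_one_div (by positivity) (by positivity)] at this
  exact le_antisymm hxy (le_of_sq_le_sq this hx.le)

theorem exists_unique_solvesCharEq {T : ℕ} (hT : 0 < T) {Δ : Fin K → ℝ} {j : Fin K}
    (hj : Δ j = 0) : ∃ n, SolvesCharEq T Δ n ∧ ∀ y, SolvesCharEq T Δ y → y = n := by
  have hT0 : (0 : ℝ) < T := by exact_mod_cast hT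
  have hd : ∀ a, 0 ≤ √(Δ a ^ 2 / (2 * Real.log T)) := fun a => Real.sqrt_nonneg _
  have hdj : √(Δ j ^ 2 / (2 * Real.log T)) = 0 := by simp [hj]
  obtain ⟨ρ, hρ, hsum⟩ := exists_sum_inv_sq_eq hd hdj hT0
  have hinv : 1 / √(1 / ρ ^ 2) = ρ := by
    rw [Real.sqrt_div zero_le_one, Real.sqrt_one, Real.sqrt_sq hρ.le, one_div_one_div]
  refine ⟨1 / ρ ^ 2, (solvesCharEq_iff hT).2 ⟨by positivity, ?_⟩, fun y hy => ?_⟩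
  · rwa [hinv]
  · obtain ⟨hy0, hysum⟩ := (solvesCharEq_iff hT).1 hy
    have hs : 0 < √y := Real.sqrt_pos.2 hy0
    have := eq_of_sum_inv_sq_eq hd hdj (one_div_pos.2 hs) hρ (hysum.trans hsum.symm)
    rw [← this, div_pow, Real.sq_sqrt hy0.le]
    simp

end CharEq

/-! ### Limits of the error terms. -/

section Limits

/-- The decay T^(-c) beats the number of dyadic blocks for every c > 0, so ε may be arbitrarily
small. -/
theorem tendsto_log_mul_exp_neg_log {c : ℝ} (hc : 0 < c) :
    Tendsto (fun T : ℕ => 2 * ((Nat.log 2 T : ℝ) + 1) * Real.exp (-(c * Real.log T)))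
      atTop (𝓝 0) := by
  have hlog : Tendsto (fun T : ℕ => Real.log T) atTop atTop :=
    Real.tendsto_log_atTop.comp tendsto_natCast_atTop_atTop
  have h1 := (tendsto_rpow_mul_exp_neg_mul_atTop_nhds_zero 1 c hc).comp hlog
  have h0 := (tendsto_rpow_mul_exp_neg_mul_atTop_nhds_zero 0 c hc).comp hlog
  have h := ((h1.const_mul (1 / Real.log 2)).add h0).const_mul 2
  simp only [mul_zero, add_zero] at h
  refine squeeze_zero' (Eventually.of_forall fun T => by positivity) ?_ h
  filter_upwards [eventually_ge_atTop 1] with T hT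
  have hl : (Nat.log 2 T : ℝ) ≤ 1 / Real.log 2 * Real.log T := by
    have := Real.natLog_le_logb T 2
    rw [Real.logb] at this
    rw [one_div_mul_eq_div]
    exact_mod_cast this
  simp only [Function.comp, Real.rpow_one, Real.rpow_zero, neg_mul]
  have he := Real.exp_pos (-(c * Real.log T))
  nlinarith [mul_le_mul_of_nonneg_right hl he.le]

/-- Both bounds are continuous in ε and equal one at ε = 0, where q = 1. -/
theorem exists_ratio_bounds_close (K : ℕ) {δ : ℝ} (hδ : 0 < δ) :
    ∃ ε q : ℝ, 0 < ε ∧ ε < 1 ∧ ((1 + ε) ^ 2 / (1 - ε)) ^ 2 = q ∧ K * (q - 1) ≤ 1 ∧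
      1 - δ < (1 - K * (q - 1)) / q ∧ (1 + K * (q - 1)) * q < 1 + δ := by
  let f : ℝ → ℝ := fun ε => ((1 + ε) ^ 2 / (1 - ε)) ^ 2
  have hf : Tendsto f (𝓝[>] 0) (𝓝 1) := by
    have : ContinuousAt f 0 := by
      refine ContinuousAt.pow (ContinuousAt.div (by fun_prop) (by fun_prop) (by norm_num)) 2
    have h0 : f 0 = 1 := by norm_num [f]
    have := this.tendsto
    rw [h0] at this
    exact this.mono_left nhdsWithin_le_nhds
  have hκ : Tendsto (fun ε => (K : ℝ) * (f ε - 1)) (𝓝[>] 0) (𝓝 0) := by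
    simpa using (hf.sub_const 1).const_mul (K : ℝ)
  have hlo : Tendsto (fun ε => (1 - (K : ℝ) * (f ε - 1)) / f ε) (𝓝[>] 0) (𝓝 1) := by
    have := (hκ.const_sub 1).div hf one_ne_zero
    rwa [sub_zero, div_one] at this
  have hup : Tendsto (fun ε => (1 + (K : ℝ) * (f ε - 1)) * f ε) (𝓝[>] 0) (𝓝 1) := by
    simpa using (hκ.const_add 1).mul hf
  have hone : ∀ᶠ ε : ℝ in 𝓝[>] 0, ε < 1 :=
    nhdsWithin_le_nhds (Iio_mem_nhds one_pos)
  have hpos : ∀ᶠ ε : ℝ in 𝓝[>] 0, 0 < ε := self_mem_nhdsWithin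
  obtain ⟨ε, h0, h1, h2, h3, h4⟩ := ((hpos.and
    (hone.and ((hκ.eventually_le_const one_pos).and
    ((hlo.eventually_const_lt (by linarith : 1 - δ < 1)).and
      (hup.eventually_lt_const (by linarith : 1 < 1 + δ)))))).exists)
  exact ⟨ε, f ε, h0, h1, rfl, h2, h3, h4⟩

theorem TendstoInProb.mul_of_tendsto_one {Ω : ℕ → Type*} [∀ T, MeasurableSpace (Ω T)]
    {P : ∀ T, Measure (Ω T)} {Y : ∀ T, Ω T → ℝ} (hY : TendstoInProb P Y 1) {c : ℕ → ℝ}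
    (hc : Tendsto c atTop (𝓝 1)) : TendstoInProb P (fun T ω => Y T ω * c T) 1 := by
  intro δ hδ
  -- Then |c T| ≤ 2, and the total error is below 2·δ/4 + δ/4 < δ.
  have hc' : ∀ᶠ T in atTop, |c T - 1| < min 1 (δ / 4) := by
    have : Tendsto (fun T => |c T - 1|) atTop (𝓝 0) := by
      simpa using (hc.sub_const 1).abs
    exact this.eventually_lt_const (by positivity)
  refine tendsto_of_tendsto_of_tendsto_of_le_of_le' tendsto_const_nhds (hY (δ / 4) (by positivity))
    (Eventually.of_forall fun T => zero_le) ?_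
  filter_upwards [hc'] with T hT
  refine measure_mono fun ω hω => ?_
  have hω : δ ≤ |Y T ω * c T - 1| := hω
  change δ / 4 ≤ |Y T ω - 1|
  by_contra! hlt
  have h1 : |c T - 1| < 1 := hT.trans_le (min_le_left _ _)
  have h2 : |c T - 1| < δ / 4 := hT.trans_le (min_le_right _ _)
  have h3 : |c T| ≤ 2 := by
    have := abs_sub_abs_le_abs_sub (c T) 1
    rw [abs_one] at this
    linarith
  have h4 : |Y T ω * c T - 1| ≤ |Y T ω - 1| * |c T| + |c T - 1| := by
    rw [← abs_mul]
    refine le_trans (le_of_eq ?_) (abs_add_le _ _)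
    ring_nf
  nlinarith [mul_le_mul_of_nonneg_left h3 (abs_nonneg (Y T ω - 1))]

end Limits

/-! ### Stability of the pull counts. -/

section Stability

/-- With probability at least one minus the failure probability of the concentration bounds, all
pairwise inequalities between the pull counts of a UCB run hold. -/
theorem measure_not_pairwise_le {Ω : Type*} [MeasurableSpace Ω] {K T : ℕ}
    {ν : Fin K → Measure ℝ} [∀ a, IsProbabilityMeasure (ν a)] {P : Measure Ω}
    [IsProbabilityMeasure P] {A : ℕ → Ω → Fin K} {X : ℕ → Ω → ℝ} (hKT : K ≤ T) (hT : 2 ≤ T)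
    (hrun : IsBanditRun T ν P A X) (hucb : IsUCB T P A X) {lam : Fin K → ℝ≥0}
    (hsub : ∀ a, IsSubGaussian (lam a) (ν a)) {v : ℝ} (hv0 : 0 < v)
    (hv : ∀ a, (lam a : ℝ) ^ 2 ≤ v) {ε : ℝ} (hε0 : 0 < ε) (hε1 : ε < 1) :
    P {ω | ¬ ((∀ a, 1 ≤ pullCount A a T ω) ∧ ∀ a b, 2 ≤ pullCount A a T ω →
        (1 - ε) / √(pullCount A b T ω) - gap ν b / √(2 * Real.log T)
          ≤ (1 + ε) / √((pullCount A a T ω : ℝ) - 1) - gap ν a / √(2 * Real.log T))}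
      ≤ K * ENNReal.ofReal
          (2 * ((Nat.log 2 T : ℝ) + 1) * Real.exp (-(ε ^ 2 / (2 * v) * Real.log T))) := by
  have hlog : 0 < Real.log T := Real.log_pos (by exact_mod_cast hT)
  have hw : 0 < √(2 * Real.log T) := Real.sqrt_pos.2 (by positivity)
  -- A deviation √(L n) of the sum is a deviation ε√(2 log T / n) of the sample mean.
  set L := ε ^ 2 * (2 * Real.log T) with hL
  have hL0 : 0 ≤ L := by positivity
  let bad : Fin K → Set Ω := fun a => {ω | ∃ t ≤ T, 1 ≤ pullCount A a t ω ∧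
    √(L * pullCount A a t ω) <
      |∑ u ∈ (Finset.range t).filter (fun u => A u ω = a), (X u ω - armMean ν a)|}
  have hbad : ∀ a, P (bad a) ≤ ENNReal.ofReal
      (2 * ((Nat.log 2 T : ℝ) + 1) * Real.exp (-(ε ^ 2 / (2 * v) * Real.log T))) := by
    intro a
    have := hrun.measure_exists_sqrt_lt_abs_sum_le (hsub a) (hv a) hv0 hL0
    have he : L / (4 * v) = ε ^ 2 / (2 * v) * Real.log T := by
      rw [hL]; field_simp; ring
    rwa [he] at this
  calc _ ≤ P (⋃ a, bad a) := by
        -- The UCB rules hold only almost surely, so the inclusion is taken up to a null set.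
        refine measure_mono_ae ?_
        filter_upwards [hucb.initial, hucb.argmax] with ω hinit hmax hω
        by_contra hcon
        refine hω ⟨fun a => (pullCount_eq_one_of_initial hinit a).ge.trans
          (pullCount_mono a hKT), fun a b ha => ?_⟩
        have hgood : ∀ a, ∀ t ≤ T, 1 ≤ pullCount A a t ω →
            |sampleMean A X a t ω - armMean ν a|
              ≤ ε * √(2 * Real.log T) / √(pullCount A a t ω) := by
          intro a t ht hn
          refine abs_sampleMean_sub_le hn ?_
          by_contra! hlt
          refine hcon (Set.mem_iUnion.2 ⟨a, t, ht, hn, ?_⟩)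
          rwa [hL, Real.sqrt_mul (by positivity), Real.sqrt_mul (by positivity),
            Real.sqrt_sq hε0.le]
        exact inv_sqrt_pullCount_sub_le hε1.le hKT hw hinit hmax hgood a b ha
    _ ≤ ∑ a, P (bad a) := measure_iUnion_fintype_le _ _
    _ ≤ ∑ _a : Fin K, _ := Finset.sum_le_sum fun a _ => hbad a
    _ = _ := by simp

/-- Stability of UCB in terms of `ρ = 1 / √n⋆`. -/
theorem tendsto_measure_pullCount_ratio {K : ℕ} (hK : 0 < K)
    (ν : ℕ → Fin K → Measure ℝ) [∀ T a, IsProbabilityMeasure (ν T a)]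
    (lam : ℕ → Fin K → ℝ≥0) (B : ℝ≥0)
    (hsub : ∀ T a, IsSubGaussian (lam T a) (ν T a)) (hlam : ∀ T a, lam T a ≤ B)
    (hgap : ∀ a, Tendsto (fun T : ℕ => gap (ν T) a / √(2 * Real.log T)) atTop (𝓝 0))
    {Ω : ℕ → Type*} [∀ T, MeasurableSpace (Ω T)]
    (P : ∀ T, Measure (Ω T)) [∀ T, IsProbabilityMeasure (P T)]
    (A : ∀ T, ℕ → Ω T → Fin K) (X : ∀ T, ℕ → Ω T → ℝ)
    (hrun : ∀ T, K ≤ T → IsBanditRun T (ν T) (P T) (A T) (X T))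
    (hucb : ∀ T, K ≤ T → IsUCB T (P T) (A T) (X T)) {ρ : ℕ → ℝ}
    (hρ : ∀ T, 2 ≤ T → 0 < ρ T ∧
      ∑ a, 1 / (ρ T + gap (ν T) a / √(2 * Real.log T)) ^ 2 = (T : ℝ)) (a : Fin K) :
    TendstoInProb P (fun T ω => (pullCount (A T) a T ω : ℝ)
      * (ρ T + gap (ν T) a / √(2 * Real.log T)) ^ 2) 1 := by
  intro δ hδ
  obtain ⟨ε, q, hε0, hε1, hqε, hκ, hlo, hup⟩ := exists_ratio_bounds_close K hδ
  have hK0 : (0 : ℝ) < K := by exact_mod_cast hK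
  -- The added 1 keeps v positive when B = 0; the peeling parameters divide by v.
  set v : ℝ := (B : ℝ) ^ 2 + 1 with hvdef
  have hv0 : 0 < v := by positivity
  have hv : ∀ T b, (lam T b : ℝ) ^ 2 ≤ v := by
    intro T b
    have : (lam T b : ℝ) ≤ B := by exact_mod_cast hlam T b
    have : (lam T b : ℝ) ^ 2 ≤ (B : ℝ) ^ 2 := by gcongr
    linarith
  -- Covers both lower bounds on the counts, 2 and 1 + 1/(2ε).
  set M : ℝ := 2 + 1 / (2 * ε) with hMdef
  have hM : 0 < M := by positivity
  have hlim : Tendsto (fun T : ℕ => (K : ℝ≥0∞) * ENNReal.ofReal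
      (2 * ((Nat.log 2 T : ℝ) + 1) * Real.exp (-(ε ^ 2 / (2 * v) * Real.log T)))) atTop (𝓝 0) := by
    have h1 := ENNReal.tendsto_ofReal
      (tendsto_log_mul_exp_neg_log (c := ε ^ 2 / (2 * v)) (by positivity))
    have h2 := ENNReal.Tendsto.const_mul h1 (Or.inr (ENNReal.natCast_ne_top K))
    simpa using h2
  have hcount : Tendsto (fun T : ℕ => 2 / √((T : ℝ) / K - 1)) atTop (𝓝 0) := by
    refine tendsto_const_nhds.div_atTop (Real.tendsto_sqrt_atTop.comp ?_)
    exact tendsto_atTop_add_const_right _ _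
      (tendsto_natCast_atTop_atTop.atTop_div_const hK0)
  have hlarge : ∀ᶠ T : ℕ in atTop, ∀ b, gap (ν T) b / √(2 * Real.log T) + 2 / √((T : ℝ) / K - 1)
      ≤ (1 - ε) / √M := by
    rw [eventually_all]
    intro b
    have := (hgap b).add hcount
    rw [add_zero] at this
    exact this.eventually_le_const (div_pos (by linarith) (Real.sqrt_pos.2 hM))
  refine tendsto_of_tendsto_of_tendsto_of_le_of_le' tendsto_const_nhds hlim
    (Eventually.of_forall fun T => zero_le) ?_
  filter_upwards [hlarge, eventually_ge_atTop 2, eventually_ge_atTop K,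
    eventually_ge_atTop (2 * K)] with T hlargeT hT2 hTK hT2K
  refine le_trans (measure_mono fun ω hω => ?_) (measure_not_pairwise_le hTK hT2 (hrun T hTK)
    (hucb T hTK) (hsub T) hv0 (hv T) hε0 hε1)
  rintro ⟨hN1, hpair⟩
  have hω : δ ≤ |(pullCount (A T) a T ω : ℝ)
      * (ρ T + gap (ν T) a / √(2 * Real.log T)) ^ 2 - 1| := hω
  obtain ⟨j, hj⟩ := exists_gap_eq_zero (ν T) hK
  have hd : ∀ b, 0 ≤ gap (ν T) b / √(2 * Real.log T) :=
    fun b => div_nonneg (gap_nonneg _ b) (Real.sqrt_nonneg _)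
  have hsumN : ∑ b, (pullCount (A T) b T ω : ℝ) = T := by
    exact_mod_cast sum_pullCount (A := A T) (ω := ω) T
  have hNM : ∀ b, M ≤ pullCount (A T) b T ω := fun b =>
    le_count_of_pairwise (N := fun b => pullCount (A T) b T ω) hd j hε0 hε1 hM
      (by exact_mod_cast hT2K) hN1 hpair hsumN b (hlargeT b)
  have hinv : 0 < 1 / (2 * ε) := by positivity
  have hN2 : ∀ b, 2 ≤ pullCount (A T) b T ω := fun b => by
    have : (2 : ℝ) ≤ pullCount (A T) b T ω := by linarith [hNM b]
    exact_mod_cast this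
  have hbounds := count_ratio_bounds (N := fun b => pullCount (A T) b T ω) hd
    (j := j) (by rw [hj, zero_div]) hε0 hε1 (hρ T hT2).1 hqε hκ hN2
    (fun b => by linarith [hNM b]) (fun b c => hpair b c (hN2 b)) hsumN (hρ T hT2).2 a
  refine absurd hω (not_le.2 (abs_lt.2 ⟨?_, ?_⟩))
  · linarith [hbounds.1]
  · linarith [hbounds.2]

/-- The term with d_j = 0 gives 1/ρ² ≤ T, hence d_a/ρ ≤ d_a√T → 0. -/
theorem tendsto_ratio_sq_of_gap {K : ℕ} {d : ℕ → Fin K → ℝ} (hd : ∀ T a, 0 ≤ d T a)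
    (hj : ∀ T, ∃ j, d T j = 0) {ρ : ℕ → ℝ}
    (hρ : ∀ T, 2 ≤ T → 0 < ρ T ∧ ∑ a, 1 / (ρ T + d T a) ^ 2 = (T : ℝ)) {a : Fin K}
    (ha : Tendsto (fun T : ℕ => d T a * √T) atTop (𝓝 0)) :
    Tendsto (fun T => (ρ T / (ρ T + d T a)) ^ 2) atTop (𝓝 1) := by
  have hratio : Tendsto (fun T => d T a / ρ T) atTop (𝓝 0) := by
    refine squeeze_zero' ?_ ?_ ha
    · filter_upwards [eventually_ge_atTop 2] with T hT
      exact div_nonneg (hd T a) (hρ T hT).1.le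
    · filter_upwards [eventually_ge_atTop 2] with T hT
      obtain ⟨hρ0, hsum⟩ := hρ T hT
      obtain ⟨j, hj⟩ := hj T
      have h1 : (1 / ρ T) ^ 2 ≤ T := by
        rw [← hsum, div_pow, one_pow]
        have := Finset.single_le_sum (f := fun b => 1 / (ρ T + d T b) ^ 2)
          (fun b _ => by positivity) (Finset.mem_univ j)
        simpa [hj] using this
      have h2 : 1 / ρ T ≤ √T := Real.le_sqrt_of_sq_le h1
      rw [div_eq_mul_one_div]
      exact mul_le_mul_of_nonneg_left h2 (hd T a)
  have h := ((hratio.const_add 1).inv₀ (by norm_num)).pow 2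
  simp only [add_zero, inv_one, one_pow] at h
  refine h.congr' ?_
  filter_upwards [eventually_ge_atTop 2] with T hT
  have hρ0 := (hρ T hT).1
  have : 0 < ρ T + d T a := add_pos_of_pos_of_nonneg hρ0 (hd T a)
  congr 1
  field_simp

theorem TendstoInProb.congr' {Ω : ℕ → Type*} [∀ T, MeasurableSpace (Ω T)]
    {P : ∀ T, Measure (Ω T)} {Y Z : ∀ T, Ω T → ℝ} {c : ℝ} (hY : TendstoInProb P Y c)
    (h : ∀ᶠ T in atTop, ∀ ω, Y T ω = Z T ω) : TendstoInProb P Z c := by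
  intro δ hδ
  refine (hY δ hδ).congr' ?_
  filter_upwards [h] with T hT
  simp only [hT]

end Stability

end UCBStability

/-! ### The main theorem, in terms of n⋆. -/

theorem theorem1
    {K : ℕ} (hK : 0 < K)
    -- the reward distributions of the arms, which may change with the horizon `T`
    (ν : ℕ → Fin K → Measure ℝ) [∀ T a, IsProbabilityMeasure (ν T a)]
    (lam : ℕ → Fin K → ℝ≥0) (B : ℝ≥0)
    (hsub : ∀ T a, UCBStability.IsSubGaussian (lam T a) (ν T a))
    (hlam : ∀ T a, lam T a ≤ B)
    (hgap : ∀ a, Tendsto (fun T : ℕ => UCBStability.gap (ν T) a / √(2 * Real.log T)) atTop (𝓝 0))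
    -- for every horizon `T ≥ K`, a run of the UCB algorithm on a probability space of its own
    {Ω : ℕ → Type*} [∀ T, MeasurableSpace (Ω T)]
    (P : ∀ T, Measure (Ω T)) [∀ T, IsProbabilityMeasure (P T)]
    (A : ∀ T, ℕ → Ω T → Fin K) (X : ∀ T, ℕ → Ω T → ℝ)
    (hrun : ∀ T, K ≤ T → UCBStability.IsBanditRun T (ν T) (P T) (A T) (X T))
    (hucb : ∀ T, K ≤ T → UCBStability.IsUCB T (P T) (A T) (X T)) :
    ∃ nstar : ℕ → ℝ,
      -- `nstar T` is the unique solution of the characteristic equation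
      (∀ T : ℕ, 2 ≤ T →
        UCBStability.SolvesCharEq T (UCBStability.gap (ν T)) (nstar T) ∧
        ∀ y, UCBStability.SolvesCharEq T (UCBStability.gap (ν T)) y → y = nstar T) ∧
      -- stability of every arm
      (∀ a, UCBStability.TendstoInProb P
        (fun T ω => (UCBStability.pullCount (A T) a T ω : ℝ) /
          (1 / √(nstar T) + √(UCBStability.gap (ν T) a ^ 2 / (2 * Real.log T))) ^ (-2 : ℤ)) 1) ∧
      -- near-optimal arms are pulled about equally often
      (∀ a, Tendsto (fun T : ℕ => UCBStability.gap (ν T) a / √(Real.log T / T)) atTop (𝓝 0) →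
        UCBStability.TendstoInProb P
          (fun T ω => (UCBStability.pullCount (A T) a T ω : ℝ) / nstar T) 1) := by

  have hsqrt : ∀ T a, √(UCBStability.gap (ν T) a ^ 2 / (2 * Real.log T))
      = UCBStability.gap (ν T) a / √(2 * Real.log T) := by
    intro T a
    rw [Real.sqrt_div (sq_nonneg _), Real.sqrt_sq (UCBStability.gap_nonneg _ a)]
  have hex : ∀ T : ℕ, ∃ n : ℝ, 2 ≤ T → UCBStability.SolvesCharEq T (UCBStability.gap (ν T)) n ∧
      ∀ y, UCBStability.SolvesCharEq T (UCBStability.gap (ν T)) y → y = n := by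
    intro T
    by_cases hT : 2 ≤ T
    · obtain ⟨j, hj⟩ := UCBStability.exists_gap_eq_zero (ν T) hK
      obtain ⟨n, hn⟩ := UCBStability.exists_unique_solvesCharEq (T := T) (by omega) hj
      exact ⟨n, fun _ => hn⟩
    -- A default value: nothing is claimed for T < 2.
    · exact ⟨0, fun h => absurd h hT⟩
  choose nstar hnstar using hex
  have hn0 : ∀ T, 2 ≤ T → 0 < nstar T := fun T hT => (hnstar T hT).1.1
  have hρ : ∀ T, 2 ≤ T → 0 < 1 / √(nstar T) ∧
      ∑ a, 1 / (1 / √(nstar T) + UCBStability.gap (ν T) a / √(2 * Real.log T)) ^ 2 = (T : ℝ) := by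
    intro T hT
    refine ⟨one_div_pos.2 (Real.sqrt_pos.2 (hn0 T hT)), ?_⟩
    simp_rw [← hsqrt]
    exact ((UCBStability.solvesCharEq_iff (by omega)).1 (hnstar T hT).1).2
  have hstab := UCBStability.tendsto_measure_pullCount_ratio hK ν lam B hsub hlam hgap P A X hrun
    hucb hρ
  refine ⟨nstar, hnstar, fun a => ?_, fun a ha => ?_⟩
  · refine (hstab a).congr' (Eventually.of_forall fun T ω => ?_)
    rw [hsqrt, zpow_neg, div_inv_eq_mul]
    rfl
  · have hd : ∀ T b, 0 ≤ UCBStability.gap (ν T) b / √(2 * Real.log T) := fun T b =>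
      div_nonneg (UCBStability.gap_nonneg _ b) (Real.sqrt_nonneg _)
    have hlim : Tendsto (fun T : ℕ => UCBStability.gap (ν T) a / √(2 * Real.log T) * √T) atTop
        (𝓝 0) := by
      have h := ha.const_mul (1 / √2)
      rw [mul_zero] at h
      refine h.congr' ?_
      filter_upwards [eventually_ge_atTop 2] with T hT
      have hlog : 0 < Real.log T := Real.log_pos (by exact_mod_cast hT)
      have hT0 : (0 : ℝ) < T := by exact_mod_cast (by omega : 0 < T)
      rw [Real.sqrt_div hlog.le, Real.sqrt_mul two_pos.le]
      field_simp
    have hc := UCBStability.tendsto_ratio_sq_of_gap hd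
      (fun T => (UCBStability.exists_gap_eq_zero (ν T) hK).imp fun j hj => by rw [hj, zero_div])
      hρ hlim
    -- N_a(ρ + d_a)² · (ρ/(ρ + d_a))² = N_a ρ² = N_a/n⋆.
    refine ((hstab a).mul_of_tendsto_one hc).congr' ?_
    filter_upwards [eventually_ge_atTop 2] with T hT ω
    have h1 := (hρ T hT).1
    have h2 : 0 < 1 / √(nstar T) + UCBStability.gap (ν T) a / √(2 * Real.log T) :=
      add_pos_of_pos_of_nonneg h1 (hd T a)
    rw [div_pow, mul_assoc, mul_div_cancel₀ _ (pow_ne_zero 2 h2.ne'), div_pow, one_pow,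
      Real.sq_sqrt (hn0 T hT).le, mul_one_div]
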